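/- Let $m\ge 1$ be an integer. Write points of $\mathbb{R}^{2m}$ as $\vec{\bm x}=(\bm x_1,\dots,\bm x_m)$ with $\bm x_j=(x_j,y_j)\in\mathbb{R}^2$, and put $Q_1(x,y)=\tfrac12(x^2-y^2)$, $B_1((x,y),(x',y'))=xx'-yy'$, $Q_m(\vec{\bm x})=\sum_{j}Q_1(\bm x_j)$, $B_m(\vec{\bm x},\vec{\bm x}')=\sum_j B_1(\bm x_j,\bm x'_j)$. Let $\mathcal{C}=\{(x,y)\in\mathbb{R}^2 : Q_1(x,y)<0,\ y>0\}$ and $E(z)=2\int_0^z e^{-\pi u^2}\,du$. For $\bm c=(c_1,c_2)\in\mathcal{C}$ put $\partial_{\bm c}(\bm x_j)=\frac{1}{\sqrt{-Q_1(\bm c)}}\left(c_1\frac{\partial}{\partial x_j}+c_2\frac{\partial}{\partial y_j}\right)$. For $\vec{\bm c}_0=(\bm c^{(0)}_1,\dots,\bm c^{(0)}_m)$, $\vec{\bm c}_1=(\bm c^{(1)}_1,\dots,\bm c^{(1)}_m)\in\mathcal{C}^m$ and a polynomial $f(\vec{\bm x})$ with complex coefficients of degree $d$ put $$p^{\vec{\bm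 c}_0,\vec{\bm c}_1}[f](\vec{\bm x})=\sum_{\sigma\in\{0,1\}^m}(-1)^{\sigma_1+\cdots+\sigma_m}\sum_{k=0}^{d}\frac{(-1)^k}{(4\pi)^k}\sum_{\substack{(k_1,\dots,k_m)\in(\mathbb{Z}_{\ge0})^m\\ k_1+\cdots+k_m=k}}\ \prod_{j=1}^m\frac{1}{k_j!}E^{(k_j)}\!\left(\frac{B_1(\bm c_j^{(\sigma_j)},\bm x_j)}{\sqrt{-Q_1(\bm c_j^{(\sigma_j)})}}\right)\cdot\left(\prod_{j=1}^m\partial_{\bm c_j^{(\sigma_j)}}(\bm x_j)^{k_j}\right)f(\vec{\bm x}).$$ For $\vec{\bm a},\vec{\bm b}\in\mathbb{R}^{2m}$, $\tau=u+iv$ with $v>0$, and $q^r=e^{2\pi i\tau r}$, put $$\theta_{\vec{\bm a},\vec{\bm b}}^{\vec{\bm c}_0,\vec{\bm c}_1}[f](\tau)=v^{-d/2}\sum_{\vec{\bm x}\in\vec{\bm a}+\mathbb{Z}^{2m}}p^{\vec{\bm c}_0,\vec{\bm c}_1}[f](\vec{\bm x}\sqrt v)\,q^{Q_m(\vec{\bm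 x})}e^{2\pi iB_m(\vec{\bm x},\vec{\bm b})}.$$ A polynomial $f$ is called spherical of degree $d$ if it is homogeneous of degree $d$ and $\sum_{j=1}^m\left(\frac{\partial^2}{\partial x_j^2}-\frac{\partial^2}{\partial y_j^2}\right)f=0$. Finally let $\operatorname{sgn}(0)=0$, $$V_m(\vec{\bm x})=\prod_{1\le i<j\le m}(x_i^2-x_j^2)(y_i^2-y_j^2)\prod_{j=1}^m x_jy_j,$$ $$\mathrm{KW}_m(\tau)=\frac{1}{4^m\,m!\left(\prod_{j=1}^m(2j-1)!\right)^2}\sum_{\substack{x_1,\dots,x_m\in\mathbb{Z}\\ y_1,\dots,y_m\in\frac12+\mathbb{Z}}}\ \prod_{j=1}^m\bigl(\operatorname{sgn}(x_j-y_j)-\operatorname{sgn}(-x_j-y_j)\bigr)\,V_m(\vec{\bm x})\prod_{j=1}^m q^{\frac12(x_j^2-y_j^2)}(-1)^{x_j-y_j-1/2}.$$ **Theorem.** For $t>0$ let $\vec{\bm c}_0(t)$ and $\vec{\bm c}_1(t)$ be the vectors all of whose components are $(1,1+t)$ and $(-1,1+t)$, respectively; they lie in $\mathcal{C}^m$. Let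 $\operatorname{Im}\tau>0$. (i) Let $f$ be a spherical polynomial, let $\vec{\bm a}\in\mathbb{R}^{2m}$ satisfy $B_1((1,1),\bm a_j)\notin\mathbb{Z}$ and $B_1((-1,1),\bm a_j)\notin\mathbb{Z}$ for all $1\le j\le m$, and let $\vec{\bm b}\in\mathbb{R}^{2m}$. Then $$\lim_{t\to0^+}\theta_{\vec{\bm a},\vec{\bm b}}^{\vec{\bm c}_0(t),\vec{\bm c}_1(t)}[f](\tau)=\sum_{\vec{\bm x}\in\vec{\bm a}+\mathbb{Z}^{2m}}\ \prod_{j=1}^m\bigl(\operatorname{sgn}(x_j-y_j)-\operatorname{sgn}(-x_j-y_j)\bigr)\,f(\vec{\bm x})\,q^{Q_m(\vec{\bm x})}e^{2\pi iB_m(\vec{\bm x},\vec{\bm b})}.$$ (ii) In particular, if all components of $\vec{\bm a}$ are $(0,\tfrac12)$, all components of $\vec{\bm b}$ are $(\tfrac12,\tfrac12)$, and $f=V_m$, then $$\lim_{t\to0^+}\theta_{\vec{\bm a},\vec{\bm b}}^{\vec{\bm c}_0(t),\vec{\bm c}_1(t)}[V_m](\tau)=(4i)^m\,m!\left(\prod_{j=1}^m(2j-1)!\right)^2\mathrm{KW}_m(\tau).$$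 All the series above (the theta series for every $t>0$, the sign-weighted series in (i), and the series defining $\mathrm{KW}_m(\tau)$) converge absolutely. -/

import Mathlib

noncomputable section

namespace KWTheta

/-- A point `(𝐱₁, …, 𝐱ₘ)` of `ℝ^{2m}`, where `𝐱ⱼ = (xⱼ, yⱼ)`. -/
abbrev Vec (m : ℕ) : Type := Fin m → ℝ × ℝ

/-- Polynomials in `x₁, …, xₘ` (indices `Sum.inl j`) and `y₁, …, yₘ` (indices `Sum.inr j`). -/
abbrev Poly (m : ℕ) : Type := MvPolynomial (Fin m ⊕ Fin m) ℂ

/-- The value `f(𝐱)` of a polynomial at a real point. -/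
def evalAt {m : ℕ} (f : Poly m) (x : Vec m) : ℂ :=
  MvPolynomial.eval (Sum.elim (fun j => ((x j).1 : ℂ)) (fun j => ((x j).2 : ℂ))) f

/-- `Q₁(x, y) = (x² - y²) / 2`. -/
def Q₁ (x : ℝ × ℝ) : ℝ := (x.1 ^ 2 - x.2 ^ 2) / 2

/-- `B₁((x, y), (x', y')) = x x' - y y'`. -/
def B₁ (x x' : ℝ × ℝ) : ℝ := x.1 * x'.1 - x.2 * x'.2

def Q {m : ℕ} (x : Vec m) : ℝ := ∑ j, Q₁ (x j)

def B {m : ℕ} (x x' : Vec m) : ℝ := ∑ j, B₁ (x j) (x' j)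

/-- The component `y > 0` of the set of negative vectors of `Q₁`. -/
def cone : Set (ℝ × ℝ) := {x | Q₁ x < 0 ∧ 0 < x.2}

/-- The error function `E(z) = 2 ∫₀^z e^{-π u²} du`. -/
def E (z : ℝ) : ℝ := 2 * ∫ u in (0 : ℝ)..z, Real.exp (-Real.pi * u ^ 2)

/-- The operator `∂_c(𝐱ⱼ) = (-Q₁(c))^{-1/2} (c₁ ∂/∂xⱼ + c₂ ∂/∂yⱼ)` on polynomials. -/
def dirDeriv {m : ℕ} (c : ℝ × ℝ) (j : Fin m) : Module.End ℂ (Poly m) :=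
  ((1 / √(-Q₁ c) : ℝ) : ℂ) •
    ((c.1 : ℂ) • (MvPolynomial.pderiv (R := ℂ) (Sum.inl j : Fin m ⊕ Fin m)).toLinearMap +
      (c.2 : ℂ) • (MvPolynomial.pderiv (R := ℂ) (Sum.inr j : Fin m ⊕ Fin m)).toLinearMap)

/-- `F_{σ,k}(𝐱)`, for vectors `c = (c₁^{(σ₁)}, …, cₘ^{(σₘ)})`. -/
def F {m : ℕ} (c : Vec m) (k : Fin m → ℕ) (x : Vec m) : ℝ :=
  ∏ j, 1 / ((k j).factorial : ℝ) * iteratedDeriv (k j) E (B₁ (c j) (x j) / √(-Q₁ (c j)))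

/-- `G_{σ,k}`, for vectors `c = (c₁^{(σ₁)}, …, cₘ^{(σₘ)})`: the composition over `j` of the
(commuting) operators `∂_{cⱼ}(𝐱ⱼ)^{kⱼ}`, applied to `f`. -/
def G {m : ℕ} (c : Vec m) (k : Fin m → ℕ) (f : Poly m) : Poly m :=
  (List.ofFn fun j => dirDeriv (c j) j ^ k j).prod f

/-- The function `p^{c₀,c₁}[f](𝐱)`; `Finset.piAntidiag Finset.univ k` is the set of all
`κ : Fin m → ℕ` with `κ₁ + ⋯ + κₘ = k`. -/
def p {m : ℕ} (c₀ c₁ : Vec m) (f : Poly m) (x : Vec m) : ℂ :=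
  ∑ σ : Fin m → Fin 2, (-1 : ℂ) ^ (∑ j, (σ j : ℕ)) *
    ∑ k ∈ Finset.range (f.totalDegree + 1), (-1 : ℂ) ^ k / (4 * (Real.pi : ℂ)) ^ k *
      ∑ κ ∈ Finset.piAntidiag (Finset.univ : Finset (Fin m)) k,
        (F (fun j => ![c₀ j, c₁ j] (σ j)) κ x : ℂ) *
          evalAt (G (fun j => ![c₀ j, c₁ j] (σ j)) κ f) x

/-- The Laplace operator `Δₘ = ∑ⱼ (∂²/∂xⱼ² - ∂²/∂yⱼ²)`. -/
def laplacian {m : ℕ} (f : Poly m) : Poly m :=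
  ∑ j : Fin m,
    (MvPolynomial.pderiv (Sum.inl j) (MvPolynomial.pderiv (Sum.inl j) f) -
      MvPolynomial.pderiv (Sum.inr j) (MvPolynomial.pderiv (Sum.inr j) f))

/-- Spherical polynomials of degree `d`. -/
def IsSpherical {m : ℕ} (f : Poly m) (d : ℕ) : Prop :=
  f.IsHomogeneous d ∧ laplacian f = 0

/-- The point `a + n` of the shifted lattice `a + ℤ^{2m}`. -/
def shift {m : ℕ} (a : Vec m) (n : Fin m → ℤ × ℤ) : Vec m :=
  fun j => ((a j).1 + ((n j).1 : ℝ), (a j).2 + ((n j).2 : ℝ))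

/-- `q^r = e^{2πiτr}` for real `r`. -/
def qPow (τ : UpperHalfPlane) (r : ℝ) : ℂ :=
  Complex.exp (2 * (Real.pi : ℂ) * Complex.I * (τ : ℂ) * (r : ℂ))

/-- `e^{2πir}` for real `r`. -/
def e (r : ℝ) : ℂ := Complex.exp (2 * (Real.pi : ℂ) * Complex.I * (r : ℂ))

/-- The summand of the theta function at a point `𝐱` of `a + ℤ^{2m}`. -/
def thetaTerm {m : ℕ} (c₀ c₁ b : Vec m) (f : Poly m) (τ : UpperHalfPlane) (x : Vec m) : ℂ :=
  p c₀ c₁ f (√τ.im • x) * qPow τ (Q x) * e (B x b)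

/-- The theta function `θ_{a,b}^{c₀,c₁}[f](τ)`; the weight factor is `v^{-d/2}`, `d = deg f`. -/
def theta {m : ℕ} (c₀ c₁ a b : Vec m) (f : Poly m) (τ : UpperHalfPlane) : ℂ :=
  ((τ.im ^ (-(f.totalDegree : ℝ) / 2) : ℝ) : ℂ) *
    ∑' n : Fin m → ℤ × ℤ, thetaTerm c₀ c₁ b f τ (shift a n)

/-- `∏ⱼ (sgn(xⱼ - yⱼ) - sgn(-xⱼ - yⱼ))`. -/
def signWeight {m : ℕ} (x : Vec m) : ℝ :=
  ∏ j, (Real.sign ((x j).1 - (x j).2) - Real.sign (-(x j).1 - (x j).2))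

/-- The summand of the sign-weighted series at a point `𝐱` of `a + ℤ^{2m}`. -/
def signTerm {m : ℕ} (b : Vec m) (f : Poly m) (τ : UpperHalfPlane) (x : Vec m) : ℂ :=
  (signWeight x : ℂ) * evalAt f x * qPow τ (Q x) * e (B x b)

/-- `c₀(t)`, all of whose components are `(1, 1 + t)`. -/
def c₀ (m : ℕ) (t : ℝ) : Vec m := fun _ => (1, 1 + t)

/-- `c₁(t)`, all of whose components are `(-1, 1 + t)`. -/
def c₁ (m : ℕ) (t : ℝ) : Vec m := fun _ => (-1, 1 + t)

/-- `Vₘ = ∏_{i<j} (xᵢ² - xⱼ²)(yᵢ² - yⱼ²) ∏ⱼ xⱼ yⱼ`. -/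
def V (m : ℕ) : Poly m :=
  (∏ i : Fin m, ∏ j ∈ Finset.Ioi i,
      ((MvPolynomial.X (Sum.inl i) ^ 2 - MvPolynomial.X (Sum.inl j) ^ 2) *
        (MvPolynomial.X (Sum.inr i) ^ 2 - MvPolynomial.X (Sum.inr j) ^ 2))) *
    ∏ j : Fin m, MvPolynomial.X (Sum.inl j) * MvPolynomial.X (Sum.inr j)

/-- The constant `m! (∏_{j=1}^m (2j-1)!)²`. -/
def kwConst (m : ℕ) : ℂ :=
  (m.factorial : ℂ) * (∏ j ∈ Finset.Icc 1 m, ((2 * j - 1).factorial : ℂ)) ^ 2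

/-- The point with `xⱼ = (n j).1 ∈ ℤ` and `yⱼ = 1/2 + (n j).2 ∈ 1/2 + ℤ`. -/
def kwPoint {m : ℕ} (n : Fin m → ℤ × ℤ) : Vec m :=
  fun j => (((n j).1 : ℝ), 1 / 2 + ((n j).2 : ℝ))

/-- The summand of the Kac-Wakimoto series. With `xⱼ = (n j).1` and `yⱼ = 1/2 + (n j).2`, the
integer `xⱼ - yⱼ - 1/2` is `(n j).1 - (n j).2 - 1`. -/
def kwTerm {m : ℕ} (τ : UpperHalfPlane) (n : Fin m → ℤ × ℤ) : ℂ :=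
  (signWeight (kwPoint n) : ℂ) * evalAt (V m) (kwPoint n) *
    ∏ j, (qPow τ (((kwPoint n j).1 ^ 2 - (kwPoint n j).2 ^ 2) / 2) *
      (-1 : ℂ) ^ ((n j).1 - (n j).2 - 1))

/-- The Kac-Wakimoto series `KWₘ(τ)`. -/
def KW (m : ℕ) (τ : UpperHalfPlane) : ℂ :=
  1 / 4 ^ m * (1 / kwConst m) * ∑' n : Fin m → ℤ × ℤ, kwTerm τ n

end KWTheta

end

noncomputable section

namespace KWTheta

open Filter Topology

/-! Everything reduces to one plane. Splitting `f` into monomials, each a product of polynomials in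
the separate pairs (xⱼ, yⱼ), turns `p` into a finite linear combination of products of
`planeFactor`s (`p_eq_sum`).

In one plane put p = x - y, r = x + y, so that 2Q₁ = pr, and s = `scale t`. The arguments of E at
the two cone vectors are p/s - sr/2 and -(r/s - sp/2). Write E = sgn + remainder; the remainder,
like every derivative of E, is a Gaussian times at most a polynomial.

For z = p/s - sr/2 one has z² + pr = p²/s² + s²r²/4, so the Gaussian more than compensates the
growth of |q^Q| where Q < 0. What is left is at most exp(-(π/4)p²/s²) exp(-(π/4)|pr|). The first
factor beats the s⁻ᵏ produced by k normalised derivatives and leaves a factor s → 0; the second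
gives convergence, since |p| and |r| stay above a positive δ on the shifted lattice
(`norm_planeRem_le`). The difference of signs vanishes where pr < 0, for every s > 0, so there too
only exp(-π|pr|) matters (`sign_sub_sign_bound`).

Hence the theta series has a summable majorant independent of t (`norm_thetaTerm_le`,
`summable_bound`), and termwise only k = 0 with its signs survives (`tendsto_p`). Dominated
convergence gives the limit, homogeneity of `f` cancelling v^(-d/2). In the Kac-Wakimoto case the
characters contribute a factor i in each plane. -/

/-! ### The error function, its derivatives and their Gaussian remainders -/

lemma hasDerivAt_E (z : ℝ) : HasDerivAt E (2 * Real.exp (-Real.pi * z ^ 2)) z := by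
  have hc : Continuous fun u : ℝ => Real.exp (-Real.pi * u ^ 2) := by fun_prop
  exact (intervalIntegral.integral_hasDerivAt_right (hc.intervalIntegrable _ _)
    (hc.stronglyMeasurableAtFilter _ _) hc.continuousAt).const_mul 2

lemma iteratedDeriv_succ_E (k : ℕ) : ∃ q : Polynomial ℝ, ∀ z,
    iteratedDeriv (k + 1) E z = q.eval z * Real.exp (-Real.pi * z ^ 2) := by
  induction k with
  | zero =>
    refine ⟨Polynomial.C 2, fun z => ?_⟩
    simp [iteratedDeriv_one, (hasDerivAt_E z).deriv]
  | succ k ih =>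
    obtain ⟨q, hq⟩ := ih
    refine ⟨q.derivative - Polynomial.C (2 * Real.pi) * Polynomial.X * q, fun z => ?_⟩
    rw [iteratedDeriv_succ, funext hq]
    have h1 : HasDerivAt (fun z : ℝ => Real.exp (-Real.pi * z ^ 2))
        (Real.exp (-Real.pi * z ^ 2) * (-Real.pi * (2 * z))) z := by
      simpa using (((hasDerivAt_id z).pow 2).const_mul (-Real.pi)).exp
    rw [((q.hasDerivAt z).fun_mul h1).deriv]
    simp
    ring

lemma abs_pow_le_exp_sq (n : ℕ) (z : ℝ) :
    |z| ^ n ≤ n.factorial * Real.exp 1 * Real.exp (Real.pi / 4 * z ^ 2) := by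
  have h := Real.pow_div_factorial_le_exp |z| (abs_nonneg z) n
  rw [div_le_iff₀ (by positivity)] at h
  have h2 : |z| ≤ 1 + Real.pi / 4 * z ^ 2 := by
    have := Real.pi_gt_three
    rw [← sq_abs z]
    nlinarith [sq_nonneg (|z| - 2 / 3), sq_nonneg |z|]
  calc |z| ^ n ≤ Real.exp |z| * n.factorial := h
    _ ≤ Real.exp (1 + Real.pi / 4 * z ^ 2) * n.factorial := by gcongr
    _ = _ := by rw [Real.exp_add]; ring

lemma abs_polynomial_eval_le (q : Polynomial ℝ) : ∃ C, 0 ≤ C ∧ ∀ z,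
    |q.eval z| ≤ C * Real.exp (Real.pi / 4 * z ^ 2) := by
  induction q using Polynomial.induction_on' with
  | add q₁ q₂ h₁ h₂ =>
    obtain ⟨C₁, h0, h₁⟩ := h₁
    obtain ⟨C₂, h0', h₂⟩ := h₂
    refine ⟨C₁ + C₂, by positivity, fun z => ?_⟩
    rw [Polynomial.eval_add, add_mul]
    exact (abs_add_le _ _).trans (add_le_add (h₁ z) (h₂ z))
  | monomial n a =>
    refine ⟨|a| * (n.factorial * Real.exp 1), by positivity, fun z => ?_⟩
    rw [Polynomial.eval_monomial, abs_mul, abs_pow, mul_assoc]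
    exact mul_le_mul_of_nonneg_left (abs_pow_le_exp_sq n z) (abs_nonneg a)

/-- The tail is 2∫ exp(-πu²) over u > z; after the shift u ↦ u + z, use (u + z)² ≥ u² + z² for u, z
≥ 0. -/
lemma one_sub_E_le {z : ℝ} (hz : 0 ≤ z) :
    0 ≤ 1 - E z ∧ 1 - E z ≤ Real.exp (-Real.pi * z ^ 2) := by
  have hi : MeasureTheory.Integrable fun u : ℝ => Real.exp (-Real.pi * u ^ 2) :=
    integrable_exp_neg_mul_sq Real.pi_pos
  have h0 : ∫ u in Set.Ioi (0 : ℝ), Real.exp (-Real.pi * u ^ 2) = 1 / 2 := by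
    rw [integral_gaussian_Ioi, div_self Real.pi_pos.ne', Real.sqrt_one]
  have h1 : 1 - E z = 2 * ∫ u in Set.Ioi z, Real.exp (-Real.pi * u ^ 2) := by
    have := intervalIntegral.integral_Ioi_sub_Ioi (a := 0) (b := z) hi.integrableOn hz
    rw [E, ← this, h0]
    ring
  have h2 : ∫ u in Set.Ioi z, Real.exp (-Real.pi * u ^ 2) =
      ∫ u in Set.Ioi (0 : ℝ), Real.exp (-Real.pi * (u + z) ^ 2) := by
    have := (MeasureTheory.measurePreserving_add_right MeasureTheory.volume
      z).setIntegral_preimage_emb (measurableEmbedding_addRight z)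
      (fun u : ℝ => Real.exp (-Real.pi * u ^ 2)) (Set.Ioi z)
    rw [← this, Set.preimage_add_const_Ioi, sub_self]
  have h3 : ∫ u in Set.Ioi (0 : ℝ), Real.exp (-Real.pi * (u + z) ^ 2) ≤
      ∫ u in Set.Ioi (0 : ℝ), Real.exp (-Real.pi * z ^ 2) * Real.exp (-Real.pi * u ^ 2) := by
    refine MeasureTheory.setIntegral_mono_on (hi.comp_add_right z).integrableOn
      (hi.const_mul _).integrableOn measurableSet_Ioi fun u hu => ?_
    rw [← Real.exp_add]
    have hu : 0 < u := hu
    have := Real.pi_pos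
    apply Real.exp_le_exp.2
    have : 0 ≤ Real.pi * (u * z) := by positivity
    nlinarith
  rw [MeasureTheory.integral_const_mul, h0] at h3
  constructor
  · rw [h1]
    have : 0 ≤ ∫ u in Set.Ioi z, Real.exp (-Real.pi * u ^ 2) :=
      MeasureTheory.setIntegral_nonneg measurableSet_Ioi fun u _ => (Real.exp_pos _).le
    positivity
  · rw [h1, h2]
    linarith

lemma E_neg (z : ℝ) : E (-z) = -E z := by
  have := intervalIntegral.integral_comp_neg (a := 0) (b := z)
    (fun u : ℝ => Real.exp (-Real.pi * u ^ 2))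
  simp only [neg_sq, neg_zero] at this
  rw [E, E, intervalIntegral.integral_symm, ← this]
  ring

lemma abs_E_sub_sign_le (z : ℝ) : |E z - Real.sign z| ≤ Real.exp (-Real.pi * z ^ 2) := by
  rcases lt_trichotomy z 0 with h | h | h
  · have := one_sub_E_le (z := -z) (by linarith)
    rw [E_neg, neg_sq] at this
    rw [Real.sign_of_neg h, abs_le]
    constructor <;> linarith
  · subst h
    simp [E]
  · have := one_sub_E_le h.le
    rw [Real.sign_of_pos h, abs_le]
    constructor <;> linarith

/-- The `k`-th derivative of `E`, minus its asymptotic value at infinity. -/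
def remE (k : ℕ) (z : ℝ) : ℝ := iteratedDeriv k E z - if k = 0 then Real.sign z else 0

/-- A quarter of the Gaussian exponent is given up to absorb the polynomial factor of the
derivatives. -/
lemma abs_remE_le (k : ℕ) : ∃ C, 0 ≤ C ∧ ∀ z,
    |remE k z| ≤ C * Real.exp (-(3 / 4 * Real.pi * z ^ 2)) := by
  cases k with
  | zero =>
    refine ⟨1, zero_le_one, fun z => ?_⟩
    have h : remE 0 z = E z - Real.sign z := by simp [remE]
    rw [h, one_mul]
    refine (abs_E_sub_sign_le z).trans (Real.exp_le_exp.2 ?_)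
    have : 0 ≤ Real.pi * z ^ 2 := by positivity
    linarith
  | succ k =>
    obtain ⟨q, hq⟩ := iteratedDeriv_succ_E k
    obtain ⟨C, hC, h⟩ := abs_polynomial_eval_le q
    refine ⟨C, hC, fun z => ?_⟩
    rw [remE, hq, if_neg (Nat.succ_ne_zero k), sub_zero, abs_mul, Real.abs_exp]
    refine (mul_le_mul_of_nonneg_right (h z) (Real.exp_pos _).le).trans_eq ?_
    rw [mul_assoc, ← Real.exp_add]
    ring_nf

/-! ### The normalised cone vectors in the coordinates x - y and x + y -/

/-- The parameter `√(t / (1 + t/2))` that measures the distance of `c₀(t)`, `c₁(t)` to the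
boundary of the cone. -/
def scale (t : ℝ) : ℝ := √(t / (1 + t / 2))

lemma scale_pos {t : ℝ} (ht : 0 < t) : 0 < scale t := Real.sqrt_pos.2 (by positivity)

lemma scale_sq {t : ℝ} (ht : 0 < t) : scale t ^ 2 = t / (1 + t / 2) :=
  Real.sq_sqrt (by positivity)

lemma scale_lt_two {t : ℝ} (ht : 0 < t) : scale t < 2 := by
  have h := scale_sq ht
  have h2 : t / (1 + t / 2) < 4 := by
    rw [div_lt_iff₀ (by positivity)]
    linarith
  nlinarith [scale_pos ht]

lemma tendsto_scale : Tendsto scale (𝓝[>] 0) (𝓝[>] 0) := by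
  refine tendsto_nhdsWithin_iff.2 ⟨?_, eventually_mem_nhdsWithin.mono fun t ht => scale_pos ht⟩
  have : ContinuousAt scale 0 := by
    unfold scale
    refine Real.continuous_sqrt.continuousAt.comp ?_
    exact ContinuousAt.div (by fun_prop) (by fun_prop) (by norm_num)
  have h := this.tendsto
  simp only [scale, zero_div, Real.sqrt_zero] at h
  exact h.mono_left nhdsWithin_le_nhds

lemma sqrt_neg_Q₁ {t : ℝ} (ht : 0 < t) {u : ℝ} (hu : u ^ 2 = 1) :
    √(-Q₁ (u, 1 + t)) = scale t * (1 + t / 2) := by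
  have h := scale_pos ht
  rw [Real.sqrt_eq_iff_mul_self_eq_of_pos (by positivity)]
  have h2 := scale_sq ht
  rw [eq_div_iff (by positivity)] at h2
  simp only [Q₁, hu]
  linear_combination (1 + t / 2) * h2

/-- Here B₁ = (1 + t/2)(x - y) - (t/2)(x + y), and the norm is s(1 + t/2) with s² = t/(1 + t/2). -/
lemma B₁_div_sqrt_zero {t : ℝ} (ht : 0 < t) (x : ℝ × ℝ) :
    B₁ (1, 1 + t) x / √(-Q₁ (1, 1 + t)) =
      (x.1 - x.2) / scale t - scale t * (x.1 + x.2) / 2 := by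
  have h := scale_pos ht
  have h2 := scale_sq ht
  rw [eq_div_iff (by positivity)] at h2
  rw [sqrt_neg_Q₁ ht (one_pow 2), B₁]
  field_simp
  linear_combination 2 * (x.1 + x.2) * h2

lemma B₁_div_sqrt_one {t : ℝ} (ht : 0 < t) (x : ℝ × ℝ) :
    B₁ (-1, 1 + t) x / √(-Q₁ (-1, 1 + t)) =
      -((x.1 + x.2) / scale t - scale t * (x.1 - x.2) / 2) := by
  have h := scale_pos ht
  have h2 := scale_sq ht
  rw [eq_div_iff (by positivity)] at h2
  rw [sqrt_neg_Q₁ ht (by norm_num), B₁]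
  field_simp
  linear_combination 2 * (x.2 - x.1) * h2

/-! ### Elementary exponential estimates -/

/-- Expanding the square produces -pr, which offsets the weight exp(-πpr) up to a quarter of pr. The
rest is the inequality |pr| ≤ p²/s² + s²r²/4 between the arithmetic and geometric means. -/
lemma gaussian_exponent_le {s : ℝ} (hs : 0 < s) (p r : ℝ) :
    -(3 / 4 * Real.pi * (p / s - s * r / 2) ^ 2) - Real.pi * (p * r) ≤
      -(Real.pi / 4 * (p ^ 2 / s ^ 2)) - Real.pi / 4 * |p * r| := by
  have h1 : (p / s - s * r / 2) ^ 2 = p ^ 2 / s ^ 2 + s ^ 2 * r ^ 2 / 4 - p * r := by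
    field_simp
    ring
  have h2 : |p * r| ≤ p ^ 2 / s ^ 2 + s ^ 2 * r ^ 2 / 4 := by
    have e1 : p ^ 2 / s ^ 2 + s ^ 2 * r ^ 2 / 4 - p * r = (p / s - s * r / 2) ^ 2 := h1.symm
    have e2 : p ^ 2 / s ^ 2 + s ^ 2 * r ^ 2 / 4 + p * r = (p / s + s * r / 2) ^ 2 := by
      field_simp
      ring
    rw [abs_le]
    constructor <;> nlinarith [sq_nonneg (p / s - s * r / 2), sq_nonneg (p / s + s * r / 2)]
  have h3 : 0 ≤ s ^ 2 * r ^ 2 / 4 := by positivity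
  have h4 := neg_abs_le (p * r)
  rw [h1]
  have : 0 ≤ Real.pi * (3 / 4 * (p ^ 2 / s ^ 2 + s ^ 2 * r ^ 2 / 4 - p * r) + p * r
      - 1 / 4 * (p ^ 2 / s ^ 2) - 1 / 4 * |p * r|) := by
    apply mul_nonneg Real.pi_pos.le
    linarith
  linarith

lemma pow_le_exp (n : ℕ) {a : ℝ} (ha : 0 < a) :
    ∃ C, 0 ≤ C ∧ ∀ w : ℝ, 0 ≤ w → w ^ n ≤ C * Real.exp (a * w) := by
  refine ⟨n.factorial / a ^ n, by positivity, fun w hw => ?_⟩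
  have h := Real.pow_div_factorial_le_exp (a * w) (by positivity) n
  rw [div_le_iff₀ (by positivity), mul_pow] at h
  rw [div_mul_eq_mul_div, le_div_iff₀ (by positivity)]
  linarith

/-- Gaussian decay in `1/s` beats every power of `1/s`. -/
lemma inv_pow_mul_exp_le (k : ℕ) {a : ℝ} (ha : 0 < a) :
    ∃ C, 0 ≤ C ∧ ∀ s : ℝ, 0 < s → s < 2 → (2 / s) ^ k * Real.exp (-(a / s ^ 2)) ≤ C * s := by
  -- The extra power of 2/s supplies the factor s on the right. The rate is a/4 because (a/4)(2/s)²
  -- = a/s², and s < 2 makes 2/s ≥ 1, so that 2/s may be replaced by its square.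
  obtain ⟨C, hC, h⟩ := pow_le_exp (k + 1) (a := a / 4) (by positivity)
  refine ⟨C / 2, by positivity, fun s hs hs2 => ?_⟩
  have h1 : 1 ≤ 2 / s := by rw [le_div_iff₀ hs]; linarith
  have h2 : (2 / s) ^ (k + 1) ≤ C * Real.exp (a / s ^ 2) := by
    calc (2 / s) ^ (k + 1) ≤ ((2 / s) ^ 2) ^ (k + 1) := by
          gcongr
          nlinarith
      _ ≤ C * Real.exp (a / 4 * (2 / s) ^ 2) := h _ (by positivity)
      _ = _ := by
          congr 2
          field_simp
          norm_num
  rw [Real.exp_neg, ← div_eq_mul_inv, div_le_iff₀ (Real.exp_pos _)]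
  rw [pow_succ, mul_div_assoc', div_le_iff₀ hs] at h2
  linarith

lemma abs_mul_ge {δ p r : ℝ} (hp : δ ≤ |p|) (hr : δ ≤ |r|) :
    δ * (|p| + |r|) / 2 ≤ |p * r| := by
  rw [abs_mul]
  nlinarith [abs_nonneg p, abs_nonneg r]

lemma abs_add_abs_le (x y : ℝ) : |x| + |y| ≤ |x - y| + |x + y| := by
  rcases abs_cases x with h | h <;> rcases abs_cases y with h' | h' <;>
    rcases abs_cases (x - y) with h'' | h'' <;> rcases abs_cases (x + y) with h3 | h3 <;> linarith

/-- Away from the null lines |pr| ≥ δ(|p| + |r|)/2 ≥ δ(|x| + |y|)/2, so the exponential decays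
linearly at rate πδ/8. Half of this rate absorbs the polynomial. -/
lemma polynomial_mul_exp_le (N : ℕ) {δ : ℝ} (hδ : 0 < δ) :
    ∃ C, 0 ≤ C ∧ ∀ x y : ℝ, δ ≤ |x - y| → δ ≤ |x + y| →
      (1 + |x| + |y|) ^ N * Real.exp (-(Real.pi / 4 * |(x - y) * (x + y)|)) ≤
        C * Real.exp (-(Real.pi / 16 * δ * (|x| + |y|))) := by
  have := Real.pi_pos
  obtain ⟨C, hC, h⟩ := pow_le_exp N (a := Real.pi / 16 * δ) (by positivity)
  refine ⟨C * Real.exp (Real.pi / 16 * δ), by positivity, fun x y hp hr => ?_⟩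
  have h1 := h (1 + |x| + |y|) (by positivity)
  have h2 := abs_mul_ge hp hr
  have h3 := abs_add_abs_le x y
  calc _ ≤ C * Real.exp (Real.pi / 16 * δ * (1 + |x| + |y|)) *
        Real.exp (-(Real.pi / 4 * |(x - y) * (x + y)|)) := by gcongr
    _ ≤ C * Real.exp (Real.pi / 16 * δ * (1 + |x| + |y|)) *
        Real.exp (-(Real.pi / 8 * δ * (|x| + |y|))) := by
          have : δ * (|x| + |y|) ≤ δ * (|x - y| + |x + y|) := by gcongr
          have h4 : Real.pi / 8 * (δ * (|x| + |y|)) ≤ Real.pi / 8 * (2 * |(x - y) * (x + y)|) :=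
            mul_le_mul_of_nonneg_left (by linarith) (by positivity)
          refine mul_le_mul_of_nonneg_left (Real.exp_le_exp.2 ?_) (by positivity)
          linarith
    _ = _ := by
          rw [mul_assoc C, mul_assoc C, ← Real.exp_add, ← Real.exp_add]
          ring_nf

/-! ### Growth of polynomials and of their directional derivatives -/

lemma norm_evalAt_one_le (g : Poly 1) : ∃ C N, 0 ≤ C ∧ ∀ x : Vec 1,
    ‖evalAt g x‖ ≤ C * (1 + |(x 0).1| + |(x 0).2|) ^ (N : ℕ) := by
  induction g using MvPolynomial.induction_on with
  | C a => exact ⟨‖a‖, 0, norm_nonneg a, fun x => by simp [evalAt]⟩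
  | add g₁ g₂ h₁ h₂ =>
    obtain ⟨C₁, N₁, h0, h₁⟩ := h₁
    obtain ⟨C₂, N₂, h0', h₂⟩ := h₂
    refine ⟨C₁ + C₂, N₁ + N₂, by positivity, fun x => ?_⟩
    have hw : 1 ≤ 1 + |(x 0).1| + |(x 0).2| := by
      linarith [abs_nonneg (x 0).1, abs_nonneg (x 0).2]
    have e : evalAt (g₁ + g₂) x = evalAt g₁ x + evalAt g₂ x := by simp [evalAt]
    rw [e, add_mul]
    refine (norm_add_le _ _).trans (add_le_add ((h₁ x).trans ?_) ((h₂ x).trans ?_)) <;>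
    · gcongr
      omega
  | mul_X g i h =>
    obtain ⟨C, N, h0, h⟩ := h
    refine ⟨C, N + 1, h0, fun x => ?_⟩
    have e : evalAt (g * MvPolynomial.X i) x = evalAt g x *
        (Sum.elim (fun j => ((x j).1 : ℂ)) (fun j => ((x j).2 : ℂ)) i) := by simp [evalAt]
    have hi : ‖Sum.elim (fun j => ((x j).1 : ℂ)) (fun j => ((x j).2 : ℂ)) i‖ ≤
        1 + |(x 0).1| + |(x 0).2| := by
      rcases i with i | i <;> rw [Subsingleton.elim i 0] <;>
        simp only [Sum.elim_inl, Sum.elim_inr, Complex.norm_real, Real.norm_eq_abs] <;>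
        linarith [abs_nonneg (x 0).1, abs_nonneg (x 0).2]
    rw [e, norm_mul, pow_succ, ← mul_assoc]
    exact mul_le_mul (h x) hi (norm_nonneg _) (by positivity)

lemma evalAt_add {m : ℕ} (f g : Poly m) (x : Vec m) :
    evalAt (f + g) x = evalAt f x + evalAt g x := by simp [evalAt]

lemma evalAt_smul {m : ℕ} (a : ℂ) (f : Poly m) (x : Vec m) :
    evalAt (a • f) x = a * evalAt f x := by simp [evalAt, MvPolynomial.smul_eval]

lemma dirDeriv_apply {m : ℕ} (c : ℝ × ℝ) (j : Fin m) (f : Poly m) :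
    dirDeriv c j f =
      ((c.1 / √(-Q₁ c) : ℝ) : ℂ) • MvPolynomial.pderiv (Sum.inl j) f +
        ((c.2 / √(-Q₁ c) : ℝ) : ℂ) • MvPolynomial.pderiv (Sum.inr j) f := by
  simp only [dirDeriv, LinearMap.smul_apply, LinearMap.add_apply, Derivation.coeFn_coe, smul_add,
    smul_smul]
  congr 2 <;> push_cast <;> ring

/-- The constants must not depend on `c`: the whole dependence on the vector sits in M^k, and M =
2/s will be used. The induction peels off the innermost derivative, hence runs over all `g`. -/
lemma norm_evalAt_dirDeriv_pow_le (k : ℕ) (g : Poly 1) : ∃ C N, 0 ≤ C ∧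
    ∀ (c : ℝ × ℝ) (M : ℝ), |c.1 / √(-Q₁ c)| ≤ M → |c.2 / √(-Q₁ c)| ≤ M → ∀ x : Vec 1,
      ‖evalAt ((dirDeriv c 0 ^ k) g) x‖ ≤ C * M ^ k * (1 + |(x 0).1| + |(x 0).2|) ^ (N : ℕ) := by
  induction k generalizing g with
  | zero =>
    obtain ⟨C, N, hC, h⟩ := norm_evalAt_one_le g
    exact ⟨C, N, hC, fun c M _ _ x => by simpa using h x⟩
  | succ k ih =>
    obtain ⟨C₁, N₁, h0, h₁⟩ := ih (MvPolynomial.pderiv (Sum.inl 0) g)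
    obtain ⟨C₂, N₂, h0', h₂⟩ := ih (MvPolynomial.pderiv (Sum.inr 0) g)
    refine ⟨C₁ + C₂, N₁ + N₂, by positivity, fun c M hc hc' x => ?_⟩
    have hM : 0 ≤ M := (abs_nonneg _).trans hc
    have hw : 1 ≤ 1 + |(x 0).1| + |(x 0).2| := by
      linarith [abs_nonneg (x 0).1, abs_nonneg (x 0).2]
    rw [pow_succ, Module.End.mul_apply, dirDeriv_apply, map_add, map_smul, map_smul, evalAt_add,
      evalAt_smul, evalAt_smul]
    set w := 1 + |(x 0).1| + |(x 0).2| with hwd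
    have b₁ : w ^ N₁ ≤ w ^ (N₁ + N₂) := pow_le_pow_right₀ hw (by omega)
    have b₂ : w ^ N₂ ≤ w ^ (N₁ + N₂) := pow_le_pow_right₀ hw (by omega)
    calc _ ≤ M * (C₁ * M ^ k * w ^ N₁) + M * (C₂ * M ^ k * w ^ N₂) := by
          refine (norm_add_le _ _).trans (add_le_add ?_ ?_) <;> rw [norm_mul, Complex.norm_real]
          · exact mul_le_mul hc (h₁ c M hc hc' x) (norm_nonneg _) hM
          · exact mul_le_mul hc' (h₂ c M hc hc' x) (norm_nonneg _) hM
      _ ≤ M * (C₁ * M ^ k * w ^ (N₁ + N₂)) + M * (C₂ * M ^ k * w ^ (N₁ + N₂)) := by gcongr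
      _ = _ := by ring

lemma abs_component_div_sqrt_le {t : ℝ} (ht : 0 < t) {u : ℝ} (hu : u ^ 2 = 1) :
    |u / √(-Q₁ (u, 1 + t))| ≤ 2 / scale t ∧ |(1 + t) / √(-Q₁ (u, 1 + t))| ≤ 2 / scale t := by
  have hs := scale_pos ht
  have hu' : |u| = 1 := by rw [← sq_eq_sq₀ (abs_nonneg u) zero_le_one, sq_abs, hu, one_pow]
  rw [sqrt_neg_Q₁ ht hu, abs_div, abs_div, hu', abs_of_pos (show (0 : ℝ) < 1 + t by linarith),
    abs_of_pos (show 0 < scale t * (1 + t / 2) by positivity)]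
  constructor <;> rw [div_le_div_iff₀ (by positivity) hs] <;> nlinarith

/-! ### The contribution of a single plane -/

/-- The factor attached to one plane `ℝ²`, for a derivative of order `k`. -/
def planeFactor (k : ℕ) (g : Poly 1) (c c' x : ℝ × ℝ) : ℂ :=
  ∑ σ : Fin 2, (-1 : ℂ) ^ (σ : ℕ) *
    (((1 / (k.factorial : ℝ) *
        iteratedDeriv k E (B₁ (![c, c'] σ) x / √(-Q₁ (![c, c'] σ))) : ℝ) : ℂ) *
      evalAt ((dirDeriv (![c, c'] σ) 0 ^ k) g) (fun _ => x))

/-- The part of `planeFactor` in which `iteratedDeriv k E` is replaced by `remE k`, for one of the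
two vectors. -/
def planeRem (k : ℕ) (g : Poly 1) (c x : ℝ × ℝ) : ℂ :=
  ((1 / (k.factorial : ℝ) * remE k (B₁ c x / √(-Q₁ c)) : ℝ) : ℂ) *
    evalAt ((dirDeriv c 0 ^ k) g) (fun _ => x)

/-- The part of `planeFactor` in which `E` is replaced by the sign function. -/
def planeMain (k : ℕ) (g : Poly 1) (c c' x : ℝ × ℝ) : ℂ :=
  if k = 0 then
    ((Real.sign (B₁ c x / √(-Q₁ c)) - Real.sign (B₁ c' x / √(-Q₁ c')) : ℝ) : ℂ) *
      evalAt g (fun _ => x)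
  else 0

lemma planeFactor_eq (k : ℕ) (g : Poly 1) (c c' x : ℝ × ℝ) :
    planeFactor k g c c' x = planeMain k g c c' x + (planeRem k g c x - planeRem k g c' x) := by
  rcases eq_or_ne k 0 with rfl | hk
  · simp [planeFactor, planeMain, planeRem, remE]
    ring
  · simp [planeFactor, planeMain, planeRem, remE, hk]
    ring

lemma Q₁_eq (x : ℝ × ℝ) : 2 * Q₁ x = (x.1 - x.2) * (x.1 + x.2) := by
  rw [Q₁]
  ring

/-- `planeRem` decays exponentially, uniformly in `t`, and tends to zero with `t`. -/
lemma norm_planeRem_le (k : ℕ) (g : Poly 1) {δ : ℝ} (hδ : 0 < δ) : ∃ C, 0 ≤ C ∧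
    ∀ t, 0 < t → ∀ u : ℝ, u = 1 ∨ u = -1 → ∀ x : ℝ × ℝ, δ ≤ |x.1 - x.2| → δ ≤ |x.1 + x.2| →
      ‖planeRem k g (u, 1 + t) x‖ * Real.exp (-(2 * Real.pi * Q₁ x)) ≤
        C * scale t * Real.exp (-(Real.pi / 16 * δ * (|x.1| + |x.2|))) := by
  obtain ⟨C₁, hC₁, h₁⟩ := abs_remE_le k
  obtain ⟨C₂, N, hC₂, h₂⟩ := norm_evalAt_dirDeriv_pow_le k g
  obtain ⟨C₃, hC₃, h₃⟩ := inv_pow_mul_exp_le k (a := Real.pi / 4 * δ ^ 2)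
    (by have := Real.pi_pos; positivity)
  obtain ⟨C₄, hC₄, h₄⟩ := polynomial_mul_exp_le N hδ
  refine ⟨1 / k.factorial * C₁ * C₂ * C₃ * C₄, by positivity, fun t ht u hu x hp hr => ?_⟩
  have hs := scale_pos ht
  have hu2 : u ^ 2 = 1 := by rcases hu with rfl | rfl <;> norm_num
  obtain ⟨ha, hb⟩ := abs_component_div_sqrt_le ht hu2
  have h₂ := h₂ (u, 1 + t) _ ha hb (fun _ => x)
  set w := 1 + |x.1| + |x.2| with hw
  set z := B₁ (u, 1 + t) x / √(-Q₁ (u, 1 + t)) with hz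
  have hexp : -(3 / 4 * Real.pi * z ^ 2) - 2 * Real.pi * Q₁ x ≤
      -(Real.pi / 4 * δ ^ 2 / scale t ^ 2) - Real.pi / 4 * |(x.1 - x.2) * (x.1 + x.2)| := by
    -- Stated for general p and r because passing from c₀(t) to c₁(t) exchanges x - y and x + y, up
    -- to a sign that disappears in z².
    have key : ∀ p r : ℝ, δ ≤ |p| →
        -(3 / 4 * Real.pi * (p / scale t - scale t * r / 2) ^ 2) - Real.pi * (p * r) ≤
        -(Real.pi / 4 * δ ^ 2 / scale t ^ 2) - Real.pi / 4 * |p * r| := by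
      intro p r hp
      refine (gaussian_exponent_le hs p r).trans ?_
      have : δ ^ 2 ≤ p ^ 2 := by rw [← sq_abs p]; gcongr
      have : Real.pi / 4 * δ ^ 2 / scale t ^ 2 ≤ Real.pi / 4 * (p ^ 2 / scale t ^ 2) := by
        rw [mul_div_assoc]
        have := Real.pi_pos
        gcongr
      linarith
    have hQ := Q₁_eq x
    rcases hu with rfl | rfl
    · rw [hz, B₁_div_sqrt_zero ht]
      refine le_trans (le_of_eq ?_) (key (x.1 - x.2) (x.1 + x.2) hp)
      rw [← hQ]
      ring
    · rw [hz, B₁_div_sqrt_one ht, mul_comm (x.1 - x.2)]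
      refine le_trans (le_of_eq ?_) (key (x.1 + x.2) (x.1 - x.2) hr)
      rw [mul_comm (x.1 + x.2) (x.1 - x.2), ← hQ]
      ring
  have h₃ := h₃ _ hs (scale_lt_two ht)
  have h₄ := h₄ x.1 x.2 hp hr
  rw [planeRem, ← hz, norm_mul, Complex.norm_real, norm_mul, Real.norm_eq_abs, Real.norm_eq_abs,
    abs_of_nonneg (show (0 : ℝ) ≤ 1 / k.factorial by positivity)]
  calc _ ≤ 1 / (k.factorial : ℝ) * (C₁ * Real.exp (-(3 / 4 * Real.pi * z ^ 2))) *
        (C₂ * (2 / scale t) ^ k * w ^ N) * Real.exp (-(2 * Real.pi * Q₁ x)) := by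
        gcongr
        · exact h₁ z
    _ = 1 / (k.factorial : ℝ) * C₁ * C₂ * (2 / scale t) ^ k * w ^ N *
        Real.exp (-(3 / 4 * Real.pi * z ^ 2) - 2 * Real.pi * Q₁ x) := by
        rw [sub_eq_add_neg, Real.exp_add]
        ring
    _ ≤ 1 / (k.factorial : ℝ) * C₁ * C₂ * (2 / scale t) ^ k * w ^ N *
        Real.exp (-(Real.pi / 4 * δ ^ 2 / scale t ^ 2) -
          Real.pi / 4 * |(x.1 - x.2) * (x.1 + x.2)|) := by
        gcongr
    _ = 1 / (k.factorial : ℝ) * C₁ * C₂ *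
        ((2 / scale t) ^ k * Real.exp (-(Real.pi / 4 * δ ^ 2 / scale t ^ 2))) *
        (w ^ N * Real.exp (-(Real.pi / 4 * |(x.1 - x.2) * (x.1 + x.2)|))) := by
        rw [sub_eq_add_neg, Real.exp_add]
        ring
    _ ≤ 1 / (k.factorial : ℝ) * C₁ * C₂ * (C₃ * scale t) *
        (C₄ * Real.exp (-(Real.pi / 16 * δ * (|x.1| + |x.2|)))) := by
        gcongr
    _ = _ := by ring

/-- If pr < 0, both arguments have the sign of p and the difference vanishes; if pr ≥ 0, the
exponential is already the one on the right. -/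
lemma sign_sub_sign_bound {s : ℝ} (hs : 0 < s) (p r : ℝ) :
    |Real.sign (p / s - s * r / 2) - Real.sign (-(r / s - s * p / 2))| *
      Real.exp (-(Real.pi * (p * r))) ≤ 2 * Real.exp (-(Real.pi * |p * r|)) := by
  have hsgn : ∀ z : ℝ, |Real.sign z| ≤ 1 := by
    intro z
    rcases Real.sign_apply_eq z with h | h | h <;> rw [h] <;> norm_num
  rcases le_or_gt 0 (p * r) with h | h
  · rw [abs_of_nonneg h]
    gcongr
    refine (abs_sub _ _).trans ?_
    linarith [hsgn (p / s - s * r / 2), hsgn (-(r / s - s * p / 2))]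
  · have : Real.sign (p / s - s * r / 2) = Real.sign (-(r / s - s * p / 2)) := by
      rcases mul_neg_iff.1 h with ⟨hp, hr⟩ | ⟨hp, hr⟩
      · have h1 : 0 < p / s := by positivity
        have h2 : s * r < 0 := mul_neg_of_pos_of_neg hs hr
        have h3 : r / s < 0 := div_neg_of_neg_of_pos hr hs
        have h4 : 0 < s * p := by positivity
        rw [Real.sign_of_pos (by linarith), Real.sign_of_pos (by linarith)]
      · have h1 : 0 < r / s := by positivity
        have h2 : s * p < 0 := mul_neg_of_pos_of_neg hs hp
        have h3 : p / s < 0 := div_neg_of_neg_of_pos hp hs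
        have h4 : 0 < s * r := by positivity
        rw [Real.sign_of_neg (by linarith), Real.sign_of_neg (by linarith)]
    rw [this, sub_self, abs_zero, zero_mul]
    positivity

lemma norm_planeMain_le (k : ℕ) (g : Poly 1) {δ : ℝ} (hδ : 0 < δ) : ∃ C, 0 ≤ C ∧
    ∀ t, 0 < t → ∀ x : ℝ × ℝ, δ ≤ |x.1 - x.2| → δ ≤ |x.1 + x.2| →
      ‖planeMain k g (1, 1 + t) (-1, 1 + t) x‖ * Real.exp (-(2 * Real.pi * Q₁ x)) ≤
        C * Real.exp (-(Real.pi / 16 * δ * (|x.1| + |x.2|))) := by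
  rcases eq_or_ne k 0 with rfl | hk
  swap
  · exact ⟨0, le_rfl, fun t _ x _ _ => by simp [planeMain, hk]⟩
  obtain ⟨C₂, N, hC₂, h₂⟩ := norm_evalAt_one_le g
  obtain ⟨C₄, hC₄, h₄⟩ := polynomial_mul_exp_le N hδ
  refine ⟨2 * C₂ * C₄, by positivity, fun t ht x hp hr => ?_⟩
  have h₄ := h₄ x.1 x.2 hp hr
  have h₁ := sign_sub_sign_bound (scale_pos ht) (x.1 - x.2) (x.1 + x.2)
  have hπ := Real.pi_pos
  rw [planeMain, if_pos rfl, B₁_div_sqrt_zero ht, B₁_div_sqrt_one ht, norm_mul,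
    Complex.norm_real, Real.norm_eq_abs]
  set S := |Real.sign ((x.1 - x.2) / scale t - scale t * (x.1 + x.2) / 2) -
    Real.sign (-((x.1 + x.2) / scale t - scale t * (x.1 - x.2) / 2))|
  set P := |(x.1 - x.2) * (x.1 + x.2)|
  calc _ = ‖evalAt g fun _ => x‖ * (S * Real.exp (-(Real.pi * ((x.1 - x.2) * (x.1 + x.2))))) := by
        rw [← Q₁_eq]
        ring_nf
    _ ≤ C₂ * (1 + |x.1| + |x.2|) ^ N * (2 * Real.exp (-(Real.pi * P))) :=
        mul_le_mul (h₂ _) h₁ (by positivity) (by positivity)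
    _ ≤ C₂ * (1 + |x.1| + |x.2|) ^ N * (2 * Real.exp (-(Real.pi / 4 * P))) := by
        have : 0 ≤ Real.pi * P := by positivity
        gcongr
        linarith
    _ = 2 * C₂ * ((1 + |x.1| + |x.2|) ^ N * Real.exp (-(Real.pi / 4 * P))) := by ring
    _ ≤ 2 * C₂ * (C₄ * Real.exp (-(Real.pi / 16 * δ * (|x.1| + |x.2|)))) := by gcongr
    _ = _ := by ring

lemma norm_planeFactor_le (k : ℕ) (g : Poly 1) {δ : ℝ} (hδ : 0 < δ) : ∃ C, 0 ≤ C ∧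
    ∀ t, 0 < t → ∀ x : ℝ × ℝ, δ ≤ |x.1 - x.2| → δ ≤ |x.1 + x.2| →
      ‖planeFactor k g (1, 1 + t) (-1, 1 + t) x‖ * Real.exp (-(2 * Real.pi * Q₁ x)) ≤
        C * Real.exp (-(Real.pi / 16 * δ * (|x.1| + |x.2|))) := by
  obtain ⟨C₁, hC₁, h₁⟩ := norm_planeMain_le k g hδ
  obtain ⟨C₂, hC₂, h₂⟩ := norm_planeRem_le k g hδ
  -- Two remainders, each carrying a factor `scale t` < 2.
  refine ⟨C₁ + 2 * (C₂ * 2), by positivity, fun t ht x hp hr => ?_⟩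
  have a₁ := h₁ t ht x hp hr
  have a₂ := h₂ t ht 1 (Or.inl rfl) x hp hr
  have a₃ := h₂ t ht (-1) (Or.inr rfl) x hp hr
  have hs := scale_lt_two ht
  have hn : ‖planeFactor k g (1, 1 + t) (-1, 1 + t) x‖ ≤
      ‖planeMain k g (1, 1 + t) (-1, 1 + t) x‖ +
        (‖planeRem k g (1, 1 + t) x‖ + ‖planeRem k g (-1, 1 + t) x‖) := by
    rw [planeFactor_eq]
    exact (norm_add_le _ _).trans (by gcongr; exact norm_sub_le _ _)
  have hb : C₂ * scale t * Real.exp (-(Real.pi / 16 * δ * (|x.1| + |x.2|))) ≤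
      C₂ * 2 * Real.exp (-(Real.pi / 16 * δ * (|x.1| + |x.2|))) := by gcongr
  have := mul_le_mul_of_nonneg_right hn (Real.exp_pos (-(2 * Real.pi * Q₁ x))).le
  linarith

lemma tendsto_planeRem (k : ℕ) (g : Poly 1) {u : ℝ} (hu : u = 1 ∨ u = -1) {x : ℝ × ℝ}
    (hp : x.1 - x.2 ≠ 0) (hr : x.1 + x.2 ≠ 0) :
    Tendsto (fun t => planeRem k g (u, 1 + t) x) (𝓝[>] 0) (𝓝 0) := by
  -- For a fixed point off the null lines its own distances serve as δ; C is then independent of t,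
  -- and the factor `scale t` forces the limit.
  obtain ⟨C, hC, h⟩ := norm_planeRem_le k g (δ := min |x.1 - x.2| |x.1 + x.2|)
    (lt_min (abs_pos.2 hp) (abs_pos.2 hr))
  have hlim := (tendsto_scale.mono_right nhdsWithin_le_nhds).mul_const
    (C * Real.exp (-(Real.pi / 16 * min |x.1 - x.2| |x.1 + x.2| * (|x.1| + |x.2|))) /
      Real.exp (-(2 * Real.pi * Q₁ x)))
  rw [zero_mul] at hlim
  refine squeeze_zero_norm' ?_ hlim
  filter_upwards [self_mem_nhdsWithin] with t ht
  have := h t ht u hu x (min_le_left _ _) (min_le_right _ _)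
  rw [mul_div_assoc', le_div_iff₀ (Real.exp_pos _)]
  linarith

lemma eventually_sign_eq {p : ℝ} (hp : p ≠ 0) (r : ℝ) :
    ∀ᶠ s in 𝓝[>] (0 : ℝ), Real.sign (p / s - s * r / 2) = Real.sign p := by
  have h : Tendsto (fun s : ℝ => p - s ^ 2 * r / 2) (𝓝[>] 0) (𝓝 p) := by
    have : ContinuousAt (fun s : ℝ => p - s ^ 2 * r / 2) 0 := by fun_prop
    have h := this.tendsto
    simp only [ne_eq, OfNat.ofNat_ne_zero, not_false_eq_true, zero_pow, zero_mul, zero_div,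
      sub_zero] at h
    exact h.mono_left nhdsWithin_le_nhds
  have e : ∀ s : ℝ, 0 < s → p / s - s * r / 2 = (p - s ^ 2 * r / 2) / s := by
    intro s hs
    field_simp
  rcases lt_or_gt_of_ne hp with hp | hp
  · filter_upwards [h.eventually_lt_const hp, self_mem_nhdsWithin] with s h1 hs
    rw [e s hs, Real.sign_of_neg hp, Real.sign_of_neg (div_neg_of_neg_of_pos h1 hs)]
  · filter_upwards [h.eventually_const_lt hp, self_mem_nhdsWithin] with s h1 hs
    rw [e s hs, Real.sign_of_pos hp, Real.sign_of_pos (div_pos h1 hs)]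

lemma tendsto_planeFactor (k : ℕ) (g : Poly 1) {x : ℝ × ℝ}
    (hp : x.1 - x.2 ≠ 0) (hr : x.1 + x.2 ≠ 0) :
    Tendsto (fun t => planeFactor k g (1, 1 + t) (-1, 1 + t) x) (𝓝[>] 0)
      (𝓝 (if k = 0 then ((Real.sign (x.1 - x.2) - Real.sign (-x.1 - x.2) : ℝ) : ℂ) *
        evalAt g (fun _ => x) else 0)) := by
  simp only [planeFactor_eq]
  have h0 := (tendsto_planeRem k g (Or.inl rfl) hp hr).sub (tendsto_planeRem k g (Or.inr rfl) hp hr)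
  rw [sub_zero] at h0
  rw [← add_zero (if k = 0 then _ else _)]
  refine Tendsto.add ?_ h0
  refine tendsto_nhds_of_eventually_eq ?_
  filter_upwards [tendsto_scale.eventually (eventually_sign_eq hp (x.1 + x.2)),
    tendsto_scale.eventually (eventually_sign_eq hr (x.1 - x.2)), self_mem_nhdsWithin]
    with t h1 h2 ht
  rw [planeMain, B₁_div_sqrt_zero ht, B₁_div_sqrt_one ht, Real.sign_neg, h1, h2, ← Real.sign_neg,
    neg_add']

/-! ### Factorisation over the planes -/

/-- The inclusion of the polynomials in `(x, y)` as the polynomials in `(xⱼ, yⱼ)`. -/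
def incl {m : ℕ} (j : Fin m) : Poly 1 →ₐ[ℂ] Poly m :=
  MvPolynomial.rename (Sum.map (fun _ => j) (fun _ => j))

lemma evalAt_incl {m : ℕ} (j : Fin m) (g : Poly 1) (x : Vec m) :
    evalAt (incl j g) x = evalAt g (fun _ => x j) := by
  rw [evalAt, incl, MvPolynomial.eval_rename, evalAt]
  congr 2
  funext i
  rcases i with i | i <;> rfl

lemma dirDeriv_mul {m : ℕ} (c : ℝ × ℝ) (j : Fin m) (f g : Poly m) :
    dirDeriv c j (f * g) = dirDeriv c j f * g + f * dirDeriv c j g := by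
  simp only [dirDeriv_apply, MvPolynomial.pderiv_mul, MvPolynomial.smul_eq_C_mul]
  ring

lemma sumMap_const_injective {m : ℕ} (j : Fin m) :
    Function.Injective (Sum.map (fun _ : Fin 1 => j) (fun _ : Fin 1 => j)) :=
  Sum.map_injective.2 ⟨Function.injective_of_subsingleton _, Function.injective_of_subsingleton _⟩

lemma dirDeriv_incl_self {m : ℕ} (c : ℝ × ℝ) (j : Fin m) (g : Poly 1) :
    dirDeriv c j (incl j g) = incl j (dirDeriv c 0 g) := by
  have h := sumMap_const_injective j
  rw [dirDeriv_apply, dirDeriv_apply, map_add, map_smul, map_smul, incl,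
    ← MvPolynomial.pderiv_rename h, ← MvPolynomial.pderiv_rename h]
  rfl

lemma dirDeriv_incl_of_ne {m : ℕ} (c : ℝ × ℝ) {i j : Fin m} (hij : i ≠ j) (g : Poly 1) :
    dirDeriv c i (incl j g) = 0 := by
  induction g using MvPolynomial.induction_on with
  | C a => simp [incl, dirDeriv_apply]
  | add g₁ g₂ h₁ h₂ => rw [map_add, map_add, h₁, h₂, add_zero]
  | mul_X g k h =>
    rw [map_mul, dirDeriv_mul, h, zero_mul, zero_add]
    rcases k with k | k <;>
      simp [incl, dirDeriv_apply, hij.symm]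

lemma dirDeriv_prod_incl_of_notMem {m : ℕ} (c : ℝ × ℝ) {i : Fin m} {s : Finset (Fin m)}
    (hi : i ∉ s) (g : Fin m → Poly 1) : dirDeriv c i (∏ j ∈ s, incl j (g j)) = 0 := by
  induction s using Finset.induction_on with
  | empty => simp [dirDeriv_apply]
  | insert a s ha ih =>
    rw [Finset.mem_insert, not_or] at hi
    rw [Finset.prod_insert ha, dirDeriv_mul, ih hi.2, dirDeriv_incl_of_ne c hi.1, zero_mul,
      mul_zero, add_zero]

lemma dirDeriv_prod_incl {m : ℕ} (c : ℝ × ℝ) (i : Fin m) (g : Fin m → Poly 1) :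
    dirDeriv c i (∏ j, incl j (g j)) =
      ∏ j, incl j (Function.update g i (dirDeriv c 0 (g i)) j) := by
  rw [← Finset.mul_prod_erase _ _ (Finset.mem_univ i), dirDeriv_mul,
    dirDeriv_prod_incl_of_notMem c (Finset.notMem_erase i _), mul_zero, add_zero,
    dirDeriv_incl_self, ← Finset.mul_prod_erase _ _ (Finset.mem_univ i), Function.update_self]
  congr 1
  exact Finset.prod_congr rfl fun j hj => by
    rw [Function.update_of_ne (Finset.ne_of_mem_erase hj)]

lemma dirDeriv_pow_prod_incl {m : ℕ} (c : ℝ × ℝ) (i : Fin m) (k : ℕ) (g : Fin m → Poly 1) :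
    (dirDeriv c i ^ k) (∏ j, incl j (g j)) =
      ∏ j, incl j (Function.update g i ((dirDeriv c 0 ^ k) (g i)) j) := by
  induction k generalizing g with
  | zero => simp
  | succ k ih =>
    rw [pow_succ, Module.End.mul_apply, dirDeriv_prod_incl, ih, Function.update_self,
      Function.update_idem, pow_succ, Module.End.mul_apply]

/-- Each operator alters only the factor of its own plane, and a list without repetitions meets
every plane at most once. -/
lemma list_prod_dirDeriv_pow_prod_incl {m : ℕ} (c : Vec m) (κ : Fin m → ℕ) (g : Fin m → Poly 1)
    {l : List (Fin m)} (hl : l.Nodup) :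
    (l.map fun j => dirDeriv (c j) j ^ κ j).prod (∏ j, incl j (g j)) =
      ∏ j, incl j (if j ∈ l then (dirDeriv (c j) 0 ^ κ j) (g j) else g j) := by
  induction l with
  | nil => simp
  | cons i l ih =>
    rw [List.nodup_cons] at hl
    rw [List.map_cons, List.prod_cons, Module.End.mul_apply, ih hl.2, dirDeriv_pow_prod_incl]
    refine Finset.prod_congr rfl fun j _ => ?_
    rcases eq_or_ne j i with rfl | hj
    · simp [hl.1]
    · simp [hj]

lemma G_prod_incl {m : ℕ} (c : Vec m) (κ : Fin m → ℕ) (g : Fin m → Poly 1) :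
    G c κ (∏ j, incl j (g j)) = ∏ j, incl j ((dirDeriv (c j) 0 ^ κ j) (g j)) := by
  rw [G, List.ofFn_eq_map, list_prod_dirDeriv_pow_prod_incl c κ g (List.nodup_finRange m)]
  simp

/-- The part of a monomial that involves the variables `xⱼ, yⱼ`. -/
def monoPart {m : ℕ} (a : (Fin m ⊕ Fin m) →₀ ℕ) (j : Fin m) : Poly 1 :=
  MvPolynomial.X (Sum.inl 0) ^ a (Sum.inl j) * MvPolynomial.X (Sum.inr 0) ^ a (Sum.inr j)

lemma monomial_eq_prod_incl {m : ℕ} (a : (Fin m ⊕ Fin m) →₀ ℕ) :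
    MvPolynomial.monomial a (1 : ℂ) = ∏ j, incl j (monoPart a j) := by
  rw [MvPolynomial.monomial_eq, Finsupp.prod_fintype _ _ (fun _ => pow_zero _),
    Fintype.prod_sum_type, ← Finset.prod_mul_distrib, MvPolynomial.C_1, one_mul]
  simp [incl, monoPart]

lemma eq_sum_smul_prod_incl {m : ℕ} (f : Poly m) :
    f = ∑ a ∈ f.support, f.coeff a • ∏ j, incl j (monoPart a j) := by
  conv_lhs => rw [f.as_sum]
  refine Finset.sum_congr rfl fun a _ => ?_
  rw [← monomial_eq_prod_incl, MvPolynomial.smul_monomial, smul_eq_mul, mul_one]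

lemma evalAt_sum {m : ℕ} {ι : Type*} (s : Finset ι) (f : ι → Poly m) (x : Vec m) :
    evalAt (∑ i ∈ s, f i) x = ∑ i ∈ s, evalAt (f i) x := by simp [evalAt]

lemma evalAt_prod_incl {m : ℕ} (g : Fin m → Poly 1) (x : Vec m) :
    evalAt (∏ j, incl j (g j)) x = ∏ j, evalAt (g j) (fun _ => x j) := by
  simp only [← evalAt_incl]
  simp [evalAt]

lemma evalAt_eq_sum {m : ℕ} (f : Poly m) (x : Vec m) :
    evalAt f x = ∑ a ∈ f.support, f.coeff a * ∏ j, evalAt (monoPart a j) (fun _ => x j) := by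
  conv_lhs => rw [eq_sum_smul_prod_incl f]
  simp only [evalAt_sum, evalAt_smul, evalAt_prod_incl]

lemma evalAt_G {m : ℕ} (c : Vec m) (κ : Fin m → ℕ) (f : Poly m) (x : Vec m) :
    evalAt (G c κ f) x = ∑ a ∈ f.support, f.coeff a *
      ∏ j, evalAt ((dirDeriv (c j) 0 ^ κ j) (monoPart a j)) (fun _ => x j) := by
  have h : G c κ f = ∑ a ∈ f.support, f.coeff a • G c κ (∏ j, incl j (monoPart a j)) := by
    conv_lhs => rw [eq_sum_smul_prod_incl f]
    simp only [G, map_sum, map_smul]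
  simp only [h, evalAt_sum, evalAt_smul, G_prod_incl, evalAt_prod_incl]

/-- For fixed `κ` and a fixed monomial, the summand belonging to σ is a product over j of terms
depending on σⱼ and 𝐱ⱼ alone. The alternating sum over σ is therefore the expansion of a product of
two-term sums. -/
lemma p_eq_sum {m : ℕ} (c c' : Vec m) (f : Poly m) (x : Vec m) :
    p c c' f x = ∑ k ∈ Finset.range (f.totalDegree + 1),
      ∑ κ ∈ Finset.piAntidiag (Finset.univ : Finset (Fin m)) k, ∑ a ∈ f.support,
        ((-1 : ℂ) ^ k / (4 * (Real.pi : ℂ)) ^ k * f.coeff a) *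
          ∏ j, planeFactor (κ j) (monoPart a j) (c j) (c' j) (x j) := by
  have hprod : ∀ (κ : Fin m → ℕ) (a : (Fin m ⊕ Fin m) →₀ ℕ),
      ∏ j, planeFactor (κ j) (monoPart a j) (c j) (c' j) (x j) =
        ∑ σ : Fin m → Fin 2, (-1 : ℂ) ^ (∑ j, (σ j : ℕ)) *
          ((F (fun j => ![c j, c' j] (σ j)) κ x : ℂ) *
            ∏ j, evalAt ((dirDeriv (![c j, c' j] (σ j)) 0 ^ κ j) (monoPart a j))
              (fun _ => x j)) := by
    intro κ a
    simp only [planeFactor]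
    rw [Finset.prod_univ_sum, Fintype.piFinset_univ]
    refine Finset.sum_congr rfl fun σ _ => ?_
    rw [Finset.prod_mul_distrib, Finset.prod_mul_distrib, Finset.prod_pow_eq_pow_sum, F,
      Complex.ofReal_prod]
  simp only [p, evalAt_G, hprod, Finset.mul_sum]
  rw [Finset.sum_comm]
  refine Finset.sum_congr rfl fun k _ => ?_
  rw [Finset.sum_comm]
  refine Finset.sum_congr rfl fun κ _ => ?_
  rw [Finset.sum_comm]
  refine Finset.sum_congr rfl fun a _ => Finset.sum_congr rfl fun σ _ => ?_
  ring

/-! ### Uniform majorants on the shifted lattice -/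

lemma summable_exp_neg_abs_add {b : ℝ} (hb : 0 < b) (α : ℝ) :
    Summable fun n : ℤ => Real.exp (-(b * |α + n|)) := by
  have h0 : Summable fun n : ℕ => Real.exp (b * |α|) * Real.exp (n * (-b)) :=
    (Real.summable_exp_nat_mul_iff.2 (by linarith)).mul_left _
  have key : ∀ w : ℝ, Real.exp (-(b * |α + w|)) ≤
      Real.exp (b * |α|) * Real.exp (|w| * (-b)) := by
    intro w
    rw [← Real.exp_add]
    apply Real.exp_le_exp.2
    have : |w| ≤ |α + w| + |α| := by
      have := abs_sub (α + w) α
      rwa [add_sub_cancel_left] at this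
    nlinarith
  refine Summable.of_nat_of_neg ?_ ?_ <;>
    refine Summable.of_nonneg_of_le (fun n => (Real.exp_pos _).le) (fun n => (key _).trans ?_) h0
  · simp
  · simp

lemma summable_pi_prod {m : ℕ} {α : Type*} (h : Fin m → α → ℝ) (h0 : ∀ j a, 0 ≤ h j a)
    (hs : ∀ j, Summable (h j)) : Summable fun n : Fin m → α => ∏ j, h j (n j) := by
  induction m with
  | zero => exact Summable.of_finite
  | succ m ih =>
    have ih := ih (fun j => h j.succ) (fun j => h0 _) (fun j => hs _)
    rw [← (Fin.consEquiv fun _ : Fin (m + 1) => α).summable_iff]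
    refine ((hs 0).mul_of_nonneg ih (h0 0) fun n => Finset.prod_nonneg fun j _ => h0 _ _).congr
      fun n => ?_
    simp [Fin.prod_univ_succ, Fin.consEquiv]

lemma exists_le_abs_add_int {α : ℝ} (h : ¬ ∃ n : ℤ, α = n) :
    ∃ δ, 0 < δ ∧ ∀ n : ℤ, δ ≤ |α + n| := by
  refine ⟨|α - round α|, abs_pos.2 fun h0 => h ⟨round α, by linarith⟩, fun n => ?_⟩
  simpa using round_le α (-n)

lemma norm_qPow (τ : UpperHalfPlane) (r : ℝ) :
    ‖qPow τ r‖ = Real.exp (-(2 * Real.pi * (τ.im * r))) := by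
  rw [qPow, Complex.norm_exp]
  congr 1
  simp
  ring

lemma norm_e (r : ℝ) : ‖e r‖ = 1 := by
  rw [e, Complex.norm_exp]
  simp

lemma Q₁_smul (r : ℝ) (x : ℝ × ℝ) : Q₁ (r • x) = r ^ 2 * Q₁ x := by
  simp [Q₁]
  ring

/-- Since v Q₁(x) = Q₁(√v x), the weight is expressed at the rescaled point where `p` is evaluated,
and v drops out of the plane estimates. -/
lemma norm_qPow_Q {m : ℕ} (τ : UpperHalfPlane) (x : Vec m) :
    ‖qPow τ (Q x)‖ = ∏ j, Real.exp (-(2 * Real.pi * Q₁ (√τ.im • x j))) := by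
  rw [norm_qPow, ← Real.exp_sum, Q, Finset.mul_sum, Finset.mul_sum, Finset.sum_neg_distrib]
  simp only [Q₁_smul, Real.sq_sqrt τ.im_pos.le]

/-- The points for which neither `x - y` nor `x + y` is small, in any of the planes. -/
def awayFrom {m : ℕ} (δ : Fin m → ℝ) : Set (Vec m) :=
  {x | ∀ j, δ j ≤ |(x j).1 - (x j).2| ∧ δ j ≤ |(x j).1 + (x j).2|}

lemma norm_prod_planeFactor_le {m : ℕ} (τ : UpperHalfPlane) {δ : Fin m → ℝ} (hδ : ∀ j, 0 < δ j)
    (κ : Fin m → ℕ) (g : Fin m → Poly 1) : ∃ C, 0 ≤ C ∧ ∀ t, 0 < t → ∀ x : Vec m,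
      √τ.im • x ∈ awayFrom δ →
      ‖∏ j, planeFactor (κ j) (g j) (c₀ m t j) (c₁ m t j) ((√τ.im • x) j)‖ * ‖qPow τ (Q x)‖ ≤
        C * ∏ j, Real.exp (-(Real.pi / 16 * δ j * (|((√τ.im • x) j).1| + |((√τ.im • x) j).2|))) := by
  choose C hC h using fun j => norm_planeFactor_le (κ j) (g j) (hδ j)
  refine ⟨∏ j, C j, Finset.prod_nonneg fun j _ => hC j, fun t ht x hx => ?_⟩
  rw [norm_qPow_Q, norm_prod, ← Finset.prod_mul_distrib, ← Finset.prod_mul_distrib]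
  exact Finset.prod_le_prod (fun j _ => by positivity) fun j _ => h j t ht _ (hx j).1 (hx j).2

/-- Used three times, for the nested sums over k, `κ` and monomials, with z the pair (t, x), so that
the constant is uniform in both. -/
lemma exists_norm_sum_mul_le {ι α : Type*} (s : Finset ι) (T : ι → α → ℂ) (w B : α → ℝ)
    (hw : ∀ z, 0 ≤ w z) (P : α → Prop)
    (h : ∀ i ∈ s, ∃ C, 0 ≤ C ∧ ∀ z, P z → ‖T i z‖ * w z ≤ C * B z) :
    ∃ C, 0 ≤ C ∧ ∀ z, P z → ‖∑ i ∈ s, T i z‖ * w z ≤ C * B z := by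
  choose! C hC h using h
  refine ⟨∑ i ∈ s, C i, Finset.sum_nonneg hC, fun z hz => ?_⟩
  rw [Finset.sum_mul]
  refine (mul_le_mul_of_nonneg_right (norm_sum_le _ _) (hw z)).trans ?_
  rw [Finset.sum_mul]
  exact Finset.sum_le_sum fun i hi => h i hi z hz

lemma norm_thetaTerm_le {m : ℕ} (τ : UpperHalfPlane) {δ : Fin m → ℝ} (hδ : ∀ j, 0 < δ j)
    (b : Vec m) (f : Poly m) : ∃ C, 0 ≤ C ∧ ∀ t, 0 < t → ∀ x : Vec m, √τ.im • x ∈ awayFrom δ →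
      ‖thetaTerm (c₀ m t) (c₁ m t) b f τ x‖ ≤
        C * ∏ j, Real.exp (-(Real.pi / 16 * δ j * (|((√τ.im • x) j).1| + |((√τ.im • x) j).2|))) := by
  obtain ⟨C, hC, h⟩ := exists_norm_sum_mul_le (Finset.range (f.totalDegree + 1))
    (fun k (z : ℝ × Vec m) => ∑ κ ∈ Finset.piAntidiag (Finset.univ : Finset (Fin m)) k,
      ∑ a ∈ f.support, ((-1 : ℂ) ^ k / (4 * (Real.pi : ℂ)) ^ k * f.coeff a) *
        ∏ j, planeFactor (κ j) (monoPart a j) (c₀ m z.1 j) (c₁ m z.1 j) ((√τ.im • z.2) j))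
    (fun z => ‖qPow τ (Q z.2)‖)
    (fun z => ∏ j, Real.exp
      (-(Real.pi / 16 * δ j * (|((√τ.im • z.2) j).1| + |((√τ.im • z.2) j).2|))))
    (fun z => norm_nonneg _) (fun z => 0 < z.1 ∧ √τ.im • z.2 ∈ awayFrom δ) (by
      intro k _
      refine exists_norm_sum_mul_le _ _ _ _ (fun z => norm_nonneg _) _ fun κ _ => ?_
      refine exists_norm_sum_mul_le _ _ _ _ (fun z => norm_nonneg _) _ fun a _ => ?_
      obtain ⟨C, hC, h⟩ := norm_prod_planeFactor_le τ hδ κ (monoPart a)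
      refine ⟨‖(-1 : ℂ) ^ k / (4 * (Real.pi : ℂ)) ^ k * f.coeff a‖ * C, by positivity,
        fun z hz => ?_⟩
      rw [norm_mul, mul_assoc, mul_assoc]
      exact mul_le_mul_of_nonneg_left (h z.1 hz.1 z.2 hz.2) (norm_nonneg _))
  refine ⟨C, hC, fun t ht x hx => ?_⟩
  rw [thetaTerm, norm_mul, norm_mul, norm_e, mul_one, p_eq_sum]
  exact h (t, x) ⟨ht, hx⟩

/-- The two products with `a j` are x - y and -(x + y). Lattice translations change them by
integers, so their distances to the nearest integer bound them below. -/
lemma smul_shift_mem_awayFrom {m : ℕ} {r : ℝ} (hr : 0 < r) {a : Vec m}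
    (ha : ∀ j, (¬ ∃ n : ℤ, B₁ (1, 1) (a j) = n) ∧ (¬ ∃ n : ℤ, B₁ (-1, 1) (a j) = n)) :
    ∃ δ : Fin m → ℝ, (∀ j, 0 < δ j) ∧ ∀ n, r • shift a n ∈ awayFrom δ := by
  choose δ hδ h using fun j => exists_le_abs_add_int (ha j).1
  choose δ' hδ' h' using fun j => exists_le_abs_add_int (ha j).2
  refine ⟨fun j => r * min (δ j) (δ' j), fun j => mul_pos hr (lt_min (hδ j) (hδ' j)),
    fun n j => ?_⟩
  have h1 := h j ((n j).1 - (n j).2)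
  have h2 := h' j (-(n j).1 - (n j).2)
  have e1 : ((r • shift a n) j).1 - ((r • shift a n) j).2 =
      r * (B₁ (1, 1) (a j) + (((n j).1 - (n j).2 : ℤ) : ℝ)) := by
    simp [shift, B₁]
    ring
  have e2 : ((r • shift a n) j).1 + ((r • shift a n) j).2 =
      -(r * (B₁ (-1, 1) (a j) + ((-(n j).1 - (n j).2 : ℤ) : ℝ))) := by
    simp [shift, B₁]
    ring
  rw [e1, e2, abs_neg, abs_mul, abs_mul, abs_of_pos hr]
  exact ⟨mul_le_mul_of_nonneg_left ((min_le_left _ _).trans h1) hr.le,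
    mul_le_mul_of_nonneg_left ((min_le_right _ _).trans h2) hr.le⟩

lemma summable_bound {m : ℕ} {r : ℝ} (hr : 0 < r) {δ : Fin m → ℝ} (hδ : ∀ j, 0 < δ j)
    (a : Vec m) : Summable fun n : Fin m → ℤ × ℤ => ∏ j, Real.exp
      (-(Real.pi / 16 * δ j * (|((r • shift a n) j).1| + |((r • shift a n) j).2|))) := by
  have hπ := Real.pi_pos
  have hpos : ∀ j, 0 < Real.pi / 16 * δ j * r := fun j => by
    have := hδ j
    positivity
  refine (summable_pi_prod (α := ℤ × ℤ) (fun j n => Real.exp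
    (-(Real.pi / 16 * δ j * r * |(a j).1 + n.1|)) * Real.exp
    (-(Real.pi / 16 * δ j * r * |(a j).2 + n.2|))) (fun j n => by positivity) fun j =>
      (summable_exp_neg_abs_add (hpos j) _).mul_of_nonneg (summable_exp_neg_abs_add (hpos j) _)
        (fun _ => (Real.exp_pos _).le) (fun _ => (Real.exp_pos _).le)).congr fun n => ?_
  refine Finset.prod_congr rfl fun j _ => ?_
  rw [← Real.exp_add]
  simp only [shift, Pi.smul_apply, Prod.smul_fst, Prod.smul_snd, smul_eq_mul, abs_mul,
    abs_of_pos hr]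
  ring_nf

/-! ### The limit of the theta series -/

lemma tendsto_p {m : ℕ} (f : Poly m) {x : Vec m}
    (hx : ∀ j, (x j).1 - (x j).2 ≠ 0 ∧ (x j).1 + (x j).2 ≠ 0) :
    Tendsto (fun t => p (c₀ m t) (c₁ m t) f x) (𝓝[>] 0)
      (𝓝 ((signWeight x : ℂ) * evalAt f x)) := by
  simp only [p_eq_sum]
  have hlim := tendsto_finsetSum (f := fun k (t : ℝ) =>
      ∑ κ ∈ Finset.piAntidiag (Finset.univ : Finset (Fin m)) k, ∑ a ∈ f.support,
        ((-1 : ℂ) ^ k / (4 * (Real.pi : ℂ)) ^ k * f.coeff a) *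
          ∏ j, planeFactor (κ j) (monoPart a j) (c₀ m t j) (c₁ m t j) (x j))
    (Finset.range (f.totalDegree + 1)) fun k _ =>
    tendsto_finsetSum (Finset.piAntidiag (Finset.univ : Finset (Fin m)) k) fun κ _ =>
    tendsto_finsetSum f.support fun a _ =>
    (tendsto_finsetProd Finset.univ fun j _ =>
      tendsto_planeFactor (κ j) (monoPart a j) (hx j).1 (hx j).2).const_mul
        ((-1 : ℂ) ^ k / (4 * (Real.pi : ℂ)) ^ k * f.coeff a)
  refine hlim.trans (le_of_eq (congrArg 𝓝 ?_))
  -- For k > 0 some `κ j` is nonzero, and the factor of that plane tends to zero.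
  rw [Finset.sum_eq_single_of_mem 0 (by simp)]
  · rw [Finset.piAntidiag_zero, Finset.sum_singleton, evalAt_eq_sum, Finset.mul_sum]
    refine Finset.sum_congr rfl fun a _ => ?_
    simp only [Pi.zero_apply, if_true, Finset.prod_mul_distrib, signWeight, Complex.ofReal_prod]
    ring
  · intro k _ hk
    refine Finset.sum_eq_zero fun κ hκ => Finset.sum_eq_zero fun a _ => ?_
    rw [Finset.mem_piAntidiag] at hκ
    obtain ⟨j, -, hj⟩ := Finset.exists_ne_zero_of_sum_ne_zero (hκ.1.trans_ne hk)
    rw [Finset.prod_eq_zero (Finset.mem_univ j) (if_neg hj), mul_zero]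

lemma sign_mul_of_pos {r : ℝ} (hr : 0 < r) (x : ℝ) : Real.sign (r * x) = Real.sign x := by
  rcases lt_trichotomy x 0 with h | h | h
  · rw [Real.sign_of_neg h, Real.sign_of_neg (mul_neg_of_pos_of_neg hr h)]
  · rw [h, mul_zero]
  · rw [Real.sign_of_pos h, Real.sign_of_pos (mul_pos hr h)]

lemma signWeight_smul {m : ℕ} {r : ℝ} (hr : 0 < r) (x : Vec m) :
    signWeight (r • x) = signWeight x := by
  refine Finset.prod_congr rfl fun j _ => ?_
  simp only [Pi.smul_apply, Prod.smul_fst, Prod.smul_snd, smul_eq_mul]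
  rw [← mul_sub, ← mul_neg, ← mul_sub, sign_mul_of_pos hr, sign_mul_of_pos hr]

lemma evalAt_smul_of_isHomogeneous {m d : ℕ} {f : Poly m} (hf : f.IsHomogeneous d) (r : ℝ)
    (x : Vec m) : evalAt f (r • x) = (r : ℂ) ^ d * evalAt f x := by
  simp only [evalAt, MvPolynomial.eval_eq, Finset.mul_sum]
  refine Finset.sum_congr rfl fun a ha => ?_
  have hd : ∑ i, a i = d := by
    rw [← Finsupp.degree_eq_sum]
    by_contra h
    exact (MvPolynomial.mem_support_iff.1 ha) (hf.coeff_eq_zero h)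
  have hs : ∀ i, Sum.elim (fun j => (((r • x) j).1 : ℂ)) (fun j => (((r • x) j).2 : ℂ)) i =
      r * Sum.elim (fun j => ((x j).1 : ℂ)) (fun j => ((x j).2 : ℂ)) i := by
    rintro (i | i) <;> simp
  have hsub : ∑ i ∈ a.support, a i = d := by
    rw [← hd]
    exact Finset.sum_subset (Finset.subset_univ _) fun i _ hi => Finsupp.notMem_support_iff.1 hi
  simp only [hs, mul_pow, Finset.prod_mul_distrib, Finset.prod_pow_eq_pow_sum, hsub]
  ring

/-- The limit formula; the Laplace equation is not needed for it. -/
lemma tendsto_theta_of_isHomogeneous {m d : ℕ} (τ : UpperHalfPlane) {f : Poly m}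
    (hf : f.IsHomogeneous d) {a : Vec m}
    (ha : ∀ j, (¬ ∃ n : ℤ, B₁ (1, 1) (a j) = n) ∧ (¬ ∃ n : ℤ, B₁ (-1, 1) (a j) = n))
    (b : Vec m) :
    (∀ t : ℝ, 0 < t → Summable fun n : Fin m → ℤ × ℤ =>
      thetaTerm (c₀ m t) (c₁ m t) b f τ (shift a n)) ∧
    (Summable fun n : Fin m → ℤ × ℤ => signTerm b f τ (shift a n)) ∧
    Tendsto (fun t : ℝ => theta (c₀ m t) (c₁ m t) a b f τ) (𝓝[>] 0)
      (𝓝 (∑' n : Fin m → ℤ × ℤ, signTerm b f τ (shift a n))) := by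
  have hv : 0 < √τ.im := Real.sqrt_pos.2 τ.im_pos
  have hdeg : ∀ x : Vec m,
      evalAt f (√τ.im • x) = (√τ.im : ℂ) ^ f.totalDegree * evalAt f x := by
    intro x
    -- The zero polynomial is homogeneous of every degree while its total degree is 0; both sides
    -- then vanish.
    rcases eq_or_ne f 0 with rfl | h0
    · simp [evalAt]
    · rw [hf.totalDegree h0, evalAt_smul_of_isHomogeneous hf]
  obtain ⟨δ, hδ, hmem⟩ := smul_shift_mem_awayFrom hv ha
  obtain ⟨C, -, hC⟩ := norm_thetaTerm_le τ hδ b f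
  have hsum := (summable_bound hv hδ a).mul_left C
  have hb := fun (t : ℝ) (ht : 0 < t) (n : Fin m → ℤ × ℤ) => hC t ht (shift a n) (hmem n)
  have hlim : ∀ n, Tendsto (fun t => thetaTerm (c₀ m t) (c₁ m t) b f τ (shift a n)) (𝓝[>] 0)
      (𝓝 ((√τ.im : ℂ) ^ f.totalDegree * signTerm b f τ (shift a n))) := by
    intro n
    have hx : ∀ j, ((√τ.im • shift a n) j).1 - ((√τ.im • shift a n) j).2 ≠ 0 ∧
        ((√τ.im • shift a n) j).1 + ((√τ.im • shift a n) j).2 ≠ 0 := fun j =>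
      ⟨abs_pos.1 ((hδ j).trans_le (hmem n j).1), abs_pos.1 ((hδ j).trans_le (hmem n j).2)⟩
    refine (((tendsto_p f hx).mul_const (qPow τ (Q (shift a n)))).mul_const
      (e (B (shift a n) b))).trans (le_of_eq (congrArg 𝓝 ?_))
    rw [signWeight_smul hv, hdeg, signTerm]
    ring
  have hsign : Summable fun n : Fin m → ℤ × ℤ =>
      (√τ.im : ℂ) ^ f.totalDegree * signTerm b f τ (shift a n) := by
    refine Summable.of_norm_bounded hsum fun n => ?_
    -- The majorant does not depend on t, so it passes to the limit and also bounds the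
    -- sign-weighted series.
    refine le_of_tendsto (hlim n).norm ?_
    filter_upwards [self_mem_nhdsWithin] with t ht using hb t ht n
  have hr0 : (√τ.im : ℂ) ^ f.totalDegree ≠ 0 := pow_ne_zero _ (Complex.ofReal_ne_zero.2 hv.ne')
  refine ⟨fun t ht => Summable.of_norm_bounded hsum (hb t ht),
    (summable_mul_left_iff hr0).1 hsign, ?_⟩
  have htsum := tendsto_tsum_of_dominated_convergence hsum hlim (by
    filter_upwards [self_mem_nhdsWithin] with t ht using hb t ht)
  rw [tsum_mul_left] at htsum
  refine (htsum.const_mul _).trans (le_of_eq (congrArg 𝓝 ?_))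
  rw [← mul_assoc]
  have hone : ((τ.im ^ (-(f.totalDegree : ℝ) / 2) : ℝ) : ℂ) * (√τ.im : ℂ) ^ f.totalDegree = 1 := by
    rw [← Complex.ofReal_pow, ← Complex.ofReal_mul, ← Complex.ofReal_one, Real.sqrt_eq_rpow,
      ← Real.rpow_natCast, ← Real.rpow_mul τ.im_pos.le, ← Real.rpow_add τ.im_pos]
    ring_nf
    simp
  rw [hone, one_mul]

/-! ### The Kac-Wakimoto series -/

lemma isHomogeneous_V (m : ℕ) : ∃ d, (V m).IsHomogeneous d := by
  have hX : ∀ i : Fin m ⊕ Fin m, (MvPolynomial.X i : Poly m).IsHomogeneous 1 :=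
    MvPolynomial.isHomogeneous_X ℂ
  exact ⟨_, (MvPolynomial.IsHomogeneous.prod _ _ _ fun i _ =>
    MvPolynomial.IsHomogeneous.prod _ _ _ fun j _ =>
      (((hX _).pow 2).sub ((hX _).pow 2)).mul (((hX _).pow 2).sub ((hX _).pow 2))).mul
    (MvPolynomial.IsHomogeneous.prod _ _ _ fun j _ => (hX _).mul (hX _))⟩

lemma qPow_sum {m : ℕ} (τ : UpperHalfPlane) (r : Fin m → ℝ) :
    qPow τ (∑ j, r j) = ∏ j, qPow τ (r j) := by
  simp only [qPow, ← Complex.exp_sum, Complex.ofReal_sum, Finset.mul_sum]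

lemma e_sum {m : ℕ} (r : Fin m → ℝ) : e (∑ j, r j) = ∏ j, e (r j) := by
  simp only [e, ← Complex.exp_sum, Complex.ofReal_sum, Finset.mul_sum]

/-- With n = x - y - 1/2, the product of (x, y) with (1/2, 1/2) is (x - y)/2 = n/2 + 1/4. This is
the source of the sign in `kwTerm` and of the factor i per plane. -/
lemma e_half_int_add_quarter (n : ℤ) : e ((n : ℝ) / 2 + 1 / 4) = Complex.I * (-1) ^ n := by
  have h : 2 * (Real.pi : ℂ) * Complex.I * (((n : ℝ) / 2 + 1 / 4 : ℝ) : ℂ) =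
      Real.pi / 2 * Complex.I + n * (Real.pi * Complex.I) := by
    push_cast
    ring
  rw [e, h, Complex.exp_add, Complex.exp_pi_div_two_mul_I, Complex.exp_int_mul,
    Complex.exp_pi_mul_I]

lemma shift_eq_kwPoint {m : ℕ} (n : Fin m → ℤ × ℤ) :
    shift (fun _ => (0, 1 / 2)) n = kwPoint n := by
  funext j
  simp [shift, kwPoint]

lemma signTerm_V_eq {m : ℕ} (τ : UpperHalfPlane) (n : Fin m → ℤ × ℤ) :
    signTerm (fun _ => (1 / 2, 1 / 2)) (V m) τ (shift (fun _ => (0, 1 / 2)) n) =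
      Complex.I ^ m * kwTerm τ n := by
  have he : e (B (kwPoint n) fun _ => (1 / 2, 1 / 2)) =
      Complex.I ^ m * ∏ j, (-1 : ℂ) ^ ((n j).1 - (n j).2 - 1) := by
    rw [B, e_sum]
    have : ∀ j, e (B₁ (kwPoint n j) (1 / 2, 1 / 2)) =
        Complex.I * (-1 : ℂ) ^ ((n j).1 - (n j).2 - 1) := fun j => by
      rw [← e_half_int_add_quarter]
      congr 1
      simp [B₁, kwPoint]
      ring
    simp only [this, Finset.prod_mul_distrib, Finset.prod_const, Finset.card_univ,
      Fintype.card_fin]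
  rw [signTerm, shift_eq_kwPoint, he, Q, qPow_sum, kwTerm, Finset.prod_mul_distrib]
  simp only [Q₁]
  ring

lemma not_int_of_abs_eq_half {α : ℝ} (h : |α| = 1 / 2) : ¬ ∃ n : ℤ, α = n := by
  rintro ⟨n, rfl⟩
  have h2 : |(2 * n : ℤ)| = 1 := by
    have : ((|2 * n| : ℤ) : ℝ) = 1 := by
      push_cast
      rw [abs_mul, h]
      norm_num
    exact_mod_cast this
  rcases abs_eq zero_le_one |>.1 h2 with h | h <;> omega

lemma kwConst_ne_zero (m : ℕ) : kwConst m ≠ 0 := by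
  refine mul_ne_zero (Nat.cast_ne_zero.2 (Nat.factorial_ne_zero m)) (pow_ne_zero _ ?_)
  exact Finset.prod_ne_zero_iff.2 fun j _ => Nat.cast_ne_zero.2 (Nat.factorial_ne_zero _)

lemma mem_cone {t : ℝ} (ht : 0 < t) {u : ℝ} (hu : u ^ 2 = 1) : (u, 1 + t) ∈ cone := by
  refine ⟨?_, ?_⟩
  · simp only [Q₁, hu]
    nlinarith
  · show 0 < 1 + t
    linarith

end KWTheta

end

theorem theorem5p7 (m : ℕ) (hm : 0 < m) (τ : UpperHalfPlane) :
    -- the vectors lie in the cone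
    (∀ t : ℝ, 0 < t → ∀ j, KWTheta.c₀ m t j ∈ KWTheta.cone ∧ KWTheta.c₁ m t j ∈ KWTheta.cone) ∧
    -- the limit for a general spherical polynomial; all the series converge absolutely
    (∀ (d : ℕ) (f : KWTheta.Poly m), KWTheta.IsSpherical f d →
      ∀ a : KWTheta.Vec m,
        (∀ j, (¬ ∃ n : ℤ, KWTheta.B₁ (1, 1) (a j) = n) ∧
          (¬ ∃ n : ℤ, KWTheta.B₁ (-1, 1) (a j) = n)) →
      ∀ b : KWTheta.Vec m,
        (∀ t : ℝ, 0 < t → Summable fun n : Fin m → ℤ × ℤ =>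
          KWTheta.thetaTerm (KWTheta.c₀ m t) (KWTheta.c₁ m t) b f τ (KWTheta.shift a n)) ∧
        (Summable fun n : Fin m → ℤ × ℤ => KWTheta.signTerm b f τ (KWTheta.shift a n)) ∧
        Filter.Tendsto
          (fun t : ℝ => KWTheta.theta (KWTheta.c₀ m t) (KWTheta.c₁ m t) a b f τ)
          (nhdsWithin 0 (Set.Ioi 0))
          (nhds (∑' n : Fin m → ℤ × ℤ, KWTheta.signTerm b f τ (KWTheta.shift a n)))) ∧
    -- the Kac-Wakimoto case; again all the series converge absolutely
    ((∀ t : ℝ, 0 < t → Summable fun n : Fin m → ℤ × ℤ =>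
        KWTheta.thetaTerm (KWTheta.c₀ m t) (KWTheta.c₁ m t) (fun _ => (1 / 2, 1 / 2))
          (KWTheta.V m) τ (KWTheta.shift (fun _ => (0, 1 / 2)) n)) ∧
      (Summable fun n : Fin m → ℤ × ℤ => KWTheta.kwTerm τ n) ∧
      Filter.Tendsto
        (fun t : ℝ => KWTheta.theta (KWTheta.c₀ m t) (KWTheta.c₁ m t)
          (fun _ => (0, 1 / 2)) (fun _ => (1 / 2, 1 / 2)) (KWTheta.V m) τ)
        (nhdsWithin 0 (Set.Ioi 0))
        (nhds ((4 * Complex.I) ^ m * (m.factorial : ℂ) *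
          (∏ j ∈ Finset.Icc 1 m, ((2 * j - 1).factorial : ℂ)) ^ 2 * KWTheta.KW m τ))) := by
  open KWTheta in
  refine ⟨fun t ht j => ⟨mem_cone ht (by norm_num), mem_cone ht (by norm_num)⟩,
    fun d f hf a ha b => tendsto_theta_of_isHomogeneous τ hf.1 ha b, ?_⟩
  obtain ⟨d, hV⟩ := KWTheta.isHomogeneous_V m
  have hI : Complex.I ^ m ≠ 0 := pow_ne_zero _ Complex.I_ne_zero
  obtain ⟨h1, h2, h3⟩ := KWTheta.tendsto_theta_of_isHomogeneous τ hV
    (a := fun _ => (0, 1 / 2))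
    -- Both products with (0, 1/2) equal -1/2.
    (fun j => ⟨KWTheta.not_int_of_abs_eq_half (by norm_num [KWTheta.B₁, abs_of_pos]),
      KWTheta.not_int_of_abs_eq_half (by norm_num [KWTheta.B₁, abs_of_pos])⟩)
    (fun _ => (1 / 2, 1 / 2))
  simp only [KWTheta.signTerm_V_eq] at h2 h3
  refine ⟨h1, (summable_mul_left_iff hI).1 h2, h3.trans (le_of_eq (congrArg nhds ?_))⟩
  have hc := KWTheta.kwConst_ne_zero m
  rw [tsum_mul_left, KWTheta.KW, mul_assoc _ (m.factorial : ℂ), ← KWTheta.kwConst, mul_pow]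
  field_simp
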